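/- Let $M$ be a connected complex manifold of dimension $m$ and let $\mathscr M(M)$ be the ring of meromorphic functions on $M$, i.e. functions that near every point are quotients $g/h$ of holomorphic functions with $h$ vanishing identically on no nonempty open set, two of them being identified if they agree on a dense open set. A $\nu$-valued algebroid function on $M$ is the multi-valued function $W$ defined by an irreducible monic equation $$P(x,W)=W^\nu+B_{\nu-1}(x)W^{\nu-1}+\cdots+B_0(x)=0,\qquad B_0,\dots,B_{\nu-1}\in\mathscr M(M).$$ In order to add and multiply multi-valued functions, branches are chosen simultaneously as follows. Fix a maximal filter $G$ of open subsets of $M$, i.e. a proper filter generated by open sets such that, for every open $U\subseteq M$, either $U\in G$ or the exterior $M\setminus\overline U\in G$ (such $G$ exist, and each contains all dense open sets). Let $\mathscr A(M)=\mathscr A_G(M)$ be the set of all branches of algebroid functions at $G$: germs along $G$ (functions being identified if they agree on a member of $G$) of functions $W$ that are holomorphic on some open $U\in G$ and satisfy, as germs along $G$, an irreducible monic equation $P(x,W)=0$ over $\mathscr M(M)$. Then $\mathscr M(M)$ is a field and, for every such $G$: (1) under the usual (pointwise) addition and multiplication, $\mathscr A(M)$ is a field with zero element $0$ and identity element $1$,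 and it contains (the germs of) $\mathscr M(M)$; every irreducible monic polynomial $P$ of degree $\nu$ over $\mathscr M(M)$ has exactly $\nu$ zeros in $\mathscr A(M)$, i.e. every $\nu$-valued algebroid function has exactly $\nu$ branches in $\mathscr A(M)$; (2) the field $\mathscr A(M)$ is algebraically closed, and it is an algebraic closure of $\mathscr M(M)$. -/

import Mathlib

open scoped Manifold ContDiff Topology Polynomial

noncomputable section

namespace Algebroid

/-- The filter on `M` of all sets that contain a dense open set. -/
def denseOpen (M : Type*) [TopologicalSpace M] : Filter M where
  sets := {s | Dense (interior s)}
  univ_sets := by simp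
  sets_of_superset := fun hs hst => hs.mono (interior_mono hst)
  inter_sets := by
    intro s t hs ht
    simp only [Set.mem_ofPred_eq, interior_inter] at *
    exact hs.inter_of_isOpen_left ht isOpen_interior

/-- A *generic place* of `M`: a maximal filter of open subsets of `M`, written as the filter on `M`
that these open sets generate. Maximality is expressed by saying that for every open `U`
either `U` or its exterior belongs to the filter.

A generic place is what is needed to choose single-valued branches of all algebroid functions
at the same time: in general no point of `M` will do, since every point may be a critical point
of some algebroid function. -/
structure GenericPlace (M : Type*) [TopologicalSpace M] where
  toFilter : Filter M
  neBot : toFilter.NeBot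
  exists_isOpen : ∀ s ∈ toFilter, ∃ U ∈ toFilter, IsOpen U ∧ U ⊆ s
  mem_or_exterior_mem : ∀ U : Set M, IsOpen U → U ∈ toFilter ∨ interior Uᶜ ∈ toFilter

theorem GenericPlace.le_denseOpen {M : Type*} [TopologicalSpace M] (G : GenericPlace M) :
    G.toFilter ≤ denseOpen M := by
  intro s hs
  have hs' : Dense (interior s) := hs
  rcases G.mem_or_exterior_mem (interior s) isOpen_interior with h | h
  · exact Filter.mem_of_superset h interior_subset
  · rw [interior_compl, hs'.closure_eq, Set.compl_univ] at h
    exact absurd h (by have := G.neBot; exact Filter.empty_notMem _)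

/-- Generic places exist on every nonempty space. -/
theorem GenericPlace.nonempty (M : Type*) [TopologicalSpace M] [Nonempty M] :
    Nonempty (GenericPlace M) := by
  have hne : (denseOpen M).NeBot := by
    refine ⟨fun h => ?_⟩
    have h0 : (∅ : Set M) ∈ denseOpen M := by rw [h]; exact Filter.mem_bot
    have h1 : Dense (interior (∅ : Set M)) := h0
    simp only [interior_empty] at h1
    simpa using h1.nonempty
  let u : Ultrafilter M := Ultrafilter.of (denseOpen M)
  have hu : (u : Filter M) ≤ denseOpen M := Ultrafilter.of_le _
  refine ⟨{ toFilter :=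
              { sets := {s | interior s ∈ u}
                univ_sets := by
                  change interior Set.univ ∈ u
                  rw [interior_univ]
                  exact Filter.univ_mem
                sets_of_superset := fun hs hst => Filter.mem_of_superset hs (interior_mono hst)
                inter_sets := by
                  intro s t hs ht
                  simp only [Set.mem_ofPred_eq, interior_inter] at *
                  exact Filter.inter_mem hs ht }
            neBot := ?_, exists_isOpen := ?_, mem_or_exterior_mem := ?_ }⟩
  · refine ⟨fun h => ?_⟩
    have h0 : (∅ : Set M) ∈ (⊥ : Filter M) := Filter.mem_bot
    rw [← h] at h0
    have h1 : interior (∅ : Set M) ∈ u := h0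
    simp at h1
  · intro s hs
    refine ⟨interior s, ?_, isOpen_interior, interior_subset⟩
    change interior (interior s) ∈ u
    rw [interior_interior]
    exact hs
  · intro U hU
    have hd : U ∪ interior Uᶜ ∈ denseOpen M := by
      change Dense (interior (U ∪ interior Uᶜ))
      rw [(hU.union isOpen_interior).interior_eq]
      intro x
      rw [interior_compl, closure_union]
      by_cases hx : x ∈ closure U
      · exact Or.inl hx
      · exact Or.inr (subset_closure hx)
    rcases Ultrafilter.union_mem_iff.1 (hu hd) with h | h
    · left
      change interior U ∈ u
      rwa [hU.interior_eq]
    · right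
      change interior (interior Uᶜ) ∈ u
      rwa [interior_interior]

section Manifold

variable (m : ℕ) {M : Type*} [TopologicalSpace M] [ChartedSpace (EuclideanSpace ℂ (Fin m)) M]

/-- `f` is holomorphic (complex analytic in charts) on `U`. -/
def HolomorphicOn (f : M → ℂ) (U : Set M) : Prop :=
  ContMDiffOn 𝓘(ℂ, EuclideanSpace ℂ (Fin m)) 𝓘(ℂ, ℂ) ω f U

/-- `f` represents a meromorphic function on `M`: near every point it is a quotient `g / h` of
holomorphic functions, where `h` vanishes identically on no nonempty open set. The values of `f`
at zeros of `h` are irrelevant. -/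
def IsMeromorphic (f : M → ℂ) : Prop :=
  ∀ x : M, ∃ U : Set M, IsOpen U ∧ x ∈ U ∧ ∃ g h : M → ℂ,
    HolomorphicOn m g U ∧ HolomorphicOn m h U ∧ U ⊆ closure {y ∈ U | h y ≠ 0} ∧
      ∀ y ∈ U, h y ≠ 0 → f y = g y / h y

variable {m}

theorem IsMeromorphic.const (c : ℂ) : IsMeromorphic m (fun _ : M => c) := fun x =>
  ⟨Set.univ, isOpen_univ, Set.mem_univ x, fun _ => c, fun _ => 1, contMDiffOn_const,
    contMDiffOn_const, by simp, by simp⟩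

theorem IsMeromorphic.neg {f : M → ℂ} (hf : IsMeromorphic m f) : IsMeromorphic m (-f) := by
  intro x
  obtain ⟨U, hU, hx, g, h, hg, hh, hd, he⟩ := hf x
  refine ⟨U, hU, hx, fun y => (-1) * g y, h, contMDiffOn_const.mul hg, hh, hd, ?_⟩
  intro y hy hy0
  simp [he y hy hy0, neg_div]

theorem dense_ne_zero_mul {U V : Set M} {h k : M → ℂ} (hU : IsOpen U) (hV : IsOpen V)
    (hh : HolomorphicOn m h U)
    (hd : U ⊆ closure {y ∈ U | h y ≠ 0}) (kd : V ⊆ closure {y ∈ V | k y ≠ 0}) :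
    U ∩ V ⊆ closure {y ∈ U ∩ V | h y * k y ≠ 0} := by
  intro x hx
  rw [mem_closure_iff]
  intro O hO hxO
  obtain ⟨y, ⟨hyO, hyV⟩, hyU, hy0⟩ :=
    mem_closure_iff.1 (hd hx.1) (O ∩ V) (hO.inter hV) ⟨hxO, hx.2⟩
  have hop : IsOpen (U ∩ h ⁻¹' {0}ᶜ) :=
    hh.continuousOn.isOpen_inter_preimage hU isClosed_singleton.isOpen_compl
  obtain ⟨z, ⟨hzO, hzU, hz0⟩, hzV, hzk⟩ :=
    mem_closure_iff.1 (kd hyV) (O ∩ (U ∩ h ⁻¹' {0}ᶜ)) (hO.inter hop) ⟨hyO, hyU, hy0⟩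
  exact ⟨z, hzO, ⟨hzU, hzV⟩, mul_ne_zero hz0 hzk⟩

theorem IsMeromorphic.add {f₁ f₂ : M → ℂ} (h₁ : IsMeromorphic m f₁) (h₂ : IsMeromorphic m f₂) :
    IsMeromorphic m (f₁ + f₂) := by
  intro x
  obtain ⟨U, hU, hxU, g, h, hg, hh, hd, he⟩ := h₁ x
  obtain ⟨V, hV, hxV, p, q, hp, hq, qd, qe⟩ := h₂ x
  have l : U ∩ V ⊆ U := Set.inter_subset_left
  have r : U ∩ V ⊆ V := Set.inter_subset_right
  refine ⟨U ∩ V, hU.inter hV, ⟨hxU, hxV⟩, fun y => g y * q y + h y * p y, fun y => h y * q y,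
    ((hg.mono l).mul (hq.mono r)).add ((hh.mono l).mul (hp.mono r)), (hh.mono l).mul (hq.mono r),
    dense_ne_zero_mul hU hV hh hd qd, ?_⟩
  intro y hy hy0
  have a := left_ne_zero_of_mul hy0
  have b := right_ne_zero_of_mul hy0
  simp only [Pi.add_apply]
  rw [he y hy.1 a, qe y hy.2 b, div_add_div _ _ a b]

theorem IsMeromorphic.mul {f₁ f₂ : M → ℂ} (h₁ : IsMeromorphic m f₁) (h₂ : IsMeromorphic m f₂) :
    IsMeromorphic m (f₁ * f₂) := by
  intro x
  obtain ⟨U, hU, hxU, g, h, hg, hh, hd, he⟩ := h₁ x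
  obtain ⟨V, hV, hxV, p, q, hp, hq, qd, qe⟩ := h₂ x
  have l : U ∩ V ⊆ U := Set.inter_subset_left
  have r : U ∩ V ⊆ V := Set.inter_subset_right
  refine ⟨U ∩ V, hU.inter hV, ⟨hxU, hxV⟩, fun y => g y * p y, fun y => h y * q y,
    (hg.mono l).mul (hp.mono r), (hh.mono l).mul (hq.mono r),
    dense_ne_zero_mul hU hV hh hd qd, ?_⟩
  intro y hy hy0
  simp only [Pi.mul_apply]
  rw [he y hy.1 (left_ne_zero_of_mul hy0), qe y hy.2 (right_ne_zero_of_mul hy0), div_mul_div_comm]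

variable (m M) in
/-- The ring of meromorphic functions on `M`; two representatives are identified if they agree
on a dense open set. -/
def MeromorphicFunctions : Subring (Filter.Germ (denseOpen M) ℂ) where
  carrier := {φ | ∃ f : M → ℂ, IsMeromorphic m f ∧ (f : Filter.Germ (denseOpen M) ℂ) = φ}
  zero_mem' := ⟨fun _ => 0, IsMeromorphic.const 0, rfl⟩
  one_mem' := ⟨fun _ => 1, IsMeromorphic.const 1, rfl⟩
  neg_mem' := by
    rintro _ ⟨f, hf, rfl⟩
    exact ⟨-f, hf.neg, rfl⟩
  add_mem' := by
    rintro _ _ ⟨f, hf, rfl⟩ ⟨g, hg, rfl⟩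
    exact ⟨f + g, hf.add hg, rfl⟩
  mul_mem' := by
    rintro _ _ ⟨f, hf, rfl⟩ ⟨g, hg, rfl⟩
    exact ⟨f * g, hf.mul hg, rfl⟩

/-- Germs of functions along a generic place, with pointwise addition and multiplication. -/
abbrev GenericPlace.Germ (G : GenericPlace M) : Type _ := Filter.Germ G.toFilter ℂ

variable (m) in
/-- The germ of a meromorphic function along a generic place. -/
def toGerm (G : GenericPlace M) : MeromorphicFunctions m M →+* G.Germ where
  toFun φ := (φ : Filter.Germ (denseOpen M) ℂ).liftOn (fun f => (f : G.Germ))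
    fun _ _ h => Filter.Germ.coe_eq.2 (G.le_denseOpen h)
  map_zero' := rfl
  map_one' := rfl
  map_add' := by
    rintro ⟨_, f, _, rfl⟩ ⟨_, g, _, rfl⟩
    rfl
  map_mul' := by
    rintro ⟨_, f, _, rfl⟩ ⟨_, g, _, rfl⟩
    rfl

variable (m) in
/-- The set of all algebroid functions on `M`, given by their branches at the generic place `G`:
germs `W` along `G` of functions holomorphic on an open set of `G` such that
`W ^ ν + B_{ν-1} W ^ (ν-1) + ⋯ + B_0 = 0` for an irreducible monic polynomial with
meromorphic coefficients `B_j` on `M`. -/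
def algebroidFunctions (G : GenericPlace M) : Set G.Germ :=
  {W | (∃ U ∈ G.toFilter, IsOpen U ∧ ∃ f : M → ℂ, HolomorphicOn m f U ∧ (f : G.Germ) = W) ∧
    ∃ P : (MeromorphicFunctions m M)[X], P.Monic ∧ Irreducible P ∧ P.eval₂ (toGerm m G) W = 0}

end Manifold

/-- The field homomorphism `i` makes `L` an algebraic closure of `K`. -/
def IsAlgebraicClosureVia {K L : Type*} [Field K] [Field L] (i : K →+* L) : Prop :=
  letI : Algebra K L := i.toAlgebra
  IsAlgClosure K L

end Algebroid

end

/-! Everything takes place in the ring `holomorphicGerms m G` of germs along `G` of functions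
holomorphic on some open member of `G`. It is a field: either the open set where `f` is nonzero
belongs to `G`, and `f⁻¹` is holomorphic there, or its exterior does, and the germ of `f` is zero.

It is also algebraically closed. In characteristic zero it suffices to find roots of separable monic
polynomials. A Bézout identity for `P` and `P'` holds pointwise on a member of `G`, so there the
specialised polynomials have simple roots, and the implicit function theorem gives local holomorphic
roots (`exists_local_root`). Monodromy is no obstacle, since members of `G` need not be connected:
local roots on a maximal disjoint family of open sets form one function (`exists_dense_solution`),
whose domain is dense enough to lie in `G`.

The meromorphic functions form a field by the identity theorem and connectedness
(`IsMeromorphic.exists_quotient`), and they embed in this field of germs. The algebroid functions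
are then the relative algebraic closure, and separability gives the count of branches. -/

noncomputable section

namespace Algebroid

/-! ### Analytic dependence of roots, and gluing on dense open sets -/

/-- A simple root of a complex polynomial depends analytically on the coefficients. -/
theorem exists_contDiffAt_root {n : ℕ} (a₀ : Fin n → ℂ) (w₀ : ℂ)
    (h0 : ∑ i, a₀ i * w₀ ^ (i : ℕ) = 0)
    (h1 : ∑ i, a₀ i * ((i : ℕ) * w₀ ^ ((i : ℕ) - 1)) ≠ 0) :
    ∃ r : (Fin n → ℂ) → ℂ, ContDiffAt ℂ ω r a₀ ∧
      ∀ᶠ a in 𝓝 a₀, ∑ i : Fin n, a i * r a ^ (i : ℕ) = 0 := by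
  let Φ : (Fin n → ℂ) × ℂ → ℂ := fun u => ∑ i, u.1 i * u.2 ^ (i : ℕ)
  have hΦ : ContDiff ℂ ω Φ := by
    refine ContDiff.sum fun i _ => ContDiff.mul ?_ (contDiff_snd.pow _)
    exact (contDiff_apply ℂ ℂ i).comp contDiff_fst
  have hd : HasDerivAt (fun w => Φ (a₀, w)) (∑ i, a₀ i * ((i : ℕ) * w₀ ^ ((i : ℕ) - 1))) w₀ :=
    HasDerivAt.fun_sum fun i _ => (hasDerivAt_pow (i : ℕ) w₀).const_mul (a₀ i)
  have hf : HasFDerivAt Φ (fderiv ℂ Φ (a₀, w₀)) (a₀, w₀) :=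
    (hΦ.differentiable (by simp) _).hasFDerivAt
  have hc := hf.comp w₀ (hasFDerivAt_prodMk_right a₀ w₀)
  have he := hc.unique hd.hasFDerivAt
  -- The partial derivative in `w` is multiplication by the nonzero number in `h1`.
  have hinv : (fderiv ℂ Φ (a₀, w₀) ∘L .inr ℂ (Fin n → ℂ) ℂ).IsInvertible := by
    rw [he]
    exact ⟨ContinuousLinearEquiv.unitsEquivAut ℂ (Units.mk0 _ h1), by ext; simp⟩
  refine ⟨hΦ.contDiffAt.implicitFunction (by simp) hinv,
    hΦ.contDiffAt.contDiffAt_implicitFunction (by simp) hinv, ?_⟩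
  filter_upwards [hΦ.contDiffAt.eventually_apply_implicitFunction (by simp) hinv] with a ha
  exact ha.trans h0

/-- Local solutions of a local condition on an open set `V` can be glued along a maximal disjoint
family of open sets to a solution on an open set that is dense in `V`. -/
theorem exists_dense_solution {X Y : Type*} [TopologicalSpace X] [Nonempty Y]
    (Q : (X → Y) → X → Prop)
    (hQ : ∀ f g x, f =ᶠ[𝓝 x] g → Q f x → Q g x) (V : Set X)
    (hV : ∀ x ∈ V, ∃ f, ∀ᶠ y in 𝓝 x, Q f y) :
    ∃ W : Set X, IsOpen W ∧ V ⊆ closure W ∧ ∃ f, ∀ y ∈ W, Q f y := by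
  classical
  obtain ⟨s, hs⟩ := zorn_subset
    {s : Set (Set X) | (∀ O ∈ s, IsOpen O ∧ ∃ f, ∀ y ∈ O, Q f y) ∧ s.PairwiseDisjoint id} (by
      intro c hc hchain
      refine ⟨⋃₀ c, ⟨?_, ?_⟩, fun t ht => Set.subset_sUnion_of_mem ht⟩
      · rintro O ⟨t, ht, hO⟩
        exact (hc ht).1 O hO
      · exact (Set.pairwiseDisjoint_sUnion hchain.directedOn).2 fun t ht => (hc ht).2)
  have hloc := hs.prop.1
  choose! F hF using fun O hO => (hloc O hO).2
  have hopen : IsOpen (⋃₀ s) := isOpen_sUnion fun O hO => (hloc O hO).1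
  refine ⟨⋃₀ s, hopen, ?_, ?_⟩
  · intro x hx
    by_contra hxc
    obtain ⟨f, hf⟩ := hV x hx
    obtain ⟨O, hO, hOo, hxO⟩ := eventually_nhds_iff.1
      (hf.and (isClosed_closure.isOpen_compl.mem_nhds hxc))
    -- `O` avoids the closure of the union, so adding it contradicts maximality.
    have hins : insert O s ∈
        {s : Set (Set X) | (∀ O ∈ s, IsOpen O ∧ ∃ f, ∀ y ∈ O, Q f y) ∧ s.PairwiseDisjoint id} := by
      refine ⟨?_, hs.prop.2.insert fun T hT _ => ?_⟩
      · rintro T (rfl | hT)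
        · exact ⟨hOo, f, fun y hy => (hO y hy).1⟩
        · exact hloc T hT
      · exact Set.disjoint_left.2 fun y hy hyT => (hO y hy).2 (subset_closure ⟨T, hT, hyT⟩)
    have hmem : O ∈ s := hs.le_of_ge hins (Set.subset_insert O s) (Set.mem_insert O s)
    exact hxc (subset_closure ⟨O, hmem, hxO⟩)
  · refine ⟨fun y => if h : ∃ O ∈ s, y ∈ O then F h.choose y else Classical.arbitrary Y, ?_⟩
    rintro y ⟨O, hO, hyO⟩
    -- By disjointness the chosen member is `O` throughout `O`, so the glued function has the same
    -- germ at `y` as `F O`; locality of `Q` does the rest.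
    refine hQ (F O) _ y ?_ (hF O hO y hyO)
    filter_upwards [(hloc O hO).1.mem_nhds hyO] with z hz
    have h : ∃ O ∈ s, z ∈ O := ⟨O, hO, hz⟩
    have heq : h.choose = O :=
      hs.prop.2.elim_set h.choose_spec.1 hO z h.choose_spec.2 hz
    rw [dif_pos h, heq]

/-- Otherwise the exterior of `W` would be in `G`, hence would meet `V`, which lies in `closure W`.
-/
theorem GenericPlace.mem_of_subset_closure {M : Type*} [TopologicalSpace M] (G : GenericPlace M)
    {V W : Set M} (hV : V ∈ G.toFilter) (hW : IsOpen W) (h : V ⊆ closure W) :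
    W ∈ G.toFilter := by
  rcases G.mem_or_exterior_mem W hW with hm | hm
  · exact hm
  · have := G.neBot
    obtain ⟨x, hxV, hx⟩ := Filter.nonempty_of_mem (Filter.inter_mem hV hm)
    rw [interior_compl] at hx
    exact absurd (h hxV) hx

/-! ### Holomorphic functions and the identity theorem -/

section Manifold

variable {m : ℕ} {M : Type*} [TopologicalSpace M] [ChartedSpace (EuclideanSpace ℂ (Fin m)) M]

theorem HolomorphicOn.inv {f : M → ℂ} {U : Set M} (hf : HolomorphicOn m f U)
    (h0 : ∀ x ∈ U, f x ≠ 0) : HolomorphicOn m f⁻¹ U := fun x hx =>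
  ContDiffAt.comp_contMDiffWithinAt (g := fun z : ℂ => z⁻¹) (contDiffAt_inv ℂ (h0 x hx)) (hf x hx)

theorem holomorphicOn_iff {f : M → ℂ} {U : Set M} (hU : IsOpen U) :
    HolomorphicOn m f U ↔
      ∀ x ∈ U, ContMDiffAt 𝓘(ℂ, EuclideanSpace ℂ (Fin m)) 𝓘(ℂ, ℂ) ω f x :=
  ⟨fun h _ hx => h.contMDiffAt (hU.mem_nhds hx), fun h x hx => (h x hx).contMDiffWithinAt⟩

theorem HolomorphicOn.isOpen_ne_zero {f : M → ℂ} {U : Set M} (hf : HolomorphicOn m f U)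
    (hU : IsOpen U) : IsOpen {y ∈ U | f y ≠ 0} :=
  hf.continuousOn.isOpen_inter_preimage hU isClosed_singleton.isOpen_compl

/-- Identity theorem: every point has arbitrarily small open neighbourhoods `V` such that a
holomorphic function on `V` vanishing on a nonempty open subset vanishes on `V`. -/
theorem exists_nhds_identity [IsManifold 𝓘(ℂ, EuclideanSpace ℂ (Fin m)) ω M] (x : M) {U : Set M}
    (hU : IsOpen U) (hx : x ∈ U) :
    ∃ V ⊆ U, IsOpen V ∧ x ∈ V ∧ ∀ g : M → ℂ, HolomorphicOn m g V →
      ∀ O ⊆ V, IsOpen O → O.Nonempty → (∀ y ∈ O, g y = 0) → ∀ y ∈ V, g y = 0 := by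
  let e := chartAt (EuclideanSpace ℂ (Fin m)) x
  have hxe : x ∈ e.source := mem_chart_source _ x
  have hT : IsOpen (e.target ∩ e.symm ⁻¹' U) := e.symm.isOpen_inter_preimage hU
  have hxT : e x ∈ e.target ∩ e.symm ⁻¹' U := ⟨e.map_source hxe, by simpa [e.left_inv hxe] using hx⟩
  obtain ⟨ε, hε, hball⟩ := Metric.isOpen_iff.1 hT _ hxT
  -- A ball in the chart is convex, hence connected, so the identity theorem for analytic functions
  -- applies on it.
  let B := Metric.ball (e x) ε
  have hBt : B ⊆ e.target := fun z hz => (hball hz).1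
  have hVo : IsOpen (e.source ∩ e ⁻¹' B) := e.isOpen_inter_preimage Metric.isOpen_ball
  refine ⟨e.source ∩ e ⁻¹' B, ?_, hVo, ⟨hxe, Metric.mem_ball_self hε⟩, ?_⟩
  · rintro y ⟨hy, hyB⟩
    simpa [e.left_inv hy] using (hball hyB).2
  intro g hg O hOV hO ⟨y, hy⟩ hzero
  have hsymm : ContMDiffOn 𝓘(ℂ, EuclideanSpace ℂ (Fin m)) 𝓘(ℂ, EuclideanSpace ℂ (Fin m)) ω
      e.symm B := (contMDiffOn_chart_symm (x := x)).mono hBt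
  have hcomp : ContMDiffOn 𝓘(ℂ, EuclideanSpace ℂ (Fin m)) 𝓘(ℂ, ℂ) ω (g ∘ e.symm) B :=
    ContMDiffOn.comp hg hsymm fun z hz =>
      ⟨e.map_target (hBt hz), by simpa [e.right_inv (hBt hz)] using hz⟩
  have han : AnalyticOnNhd ℂ (g ∘ e.symm) B :=
    Metric.isOpen_ball.analyticOn_iff_analyticOnNhd.1 (contMDiffOn_iff_contDiffOn.1 hcomp).analyticOn
  have hzB : e y ∈ B := (hOV hy).2
  have hev : (g ∘ e.symm) =ᶠ[𝓝 (e y)] 0 := by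
    have : e.target ∩ e.symm ⁻¹' O ∈ 𝓝 (e y) :=
      (e.symm.isOpen_inter_preimage hO).mem_nhds
        ⟨hBt hzB, by simpa [e.left_inv (hOV hy).1] using hy⟩
    filter_upwards [this] with z hz
    exact hzero _ hz.2
  have hconn : IsPreconnected B := (convex_ball (e x) ε).isPreconnected
  intro z hz
  have := han.eqOn_zero_of_preconnected_of_eventuallyEq_zero hconn hzB hev hz.2
  simpa [e.left_inv hz.1] using this

end Manifold

/-! ### Algebraically closed fields and relative algebraic closures -/

theorem _root_.IsField.isAlgClosed_of_exists_root {H : Type*} [CommRing H] (hH : IsField H)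
    [CharZero H]
    (hroot : ∀ P : H[X], P.Monic → P.Separable → P.natDegree ≠ 0 → ∃ x, P.eval x = 0) :
    letI : Field H := hH.toField
    IsAlgClosed H := by
  let : Field H := hH.toField
  have : CharZero H := ‹_›
  exact IsAlgClosed.of_exists_root H fun p hm hi =>
    hroot p hm hi.separable hi.natDegree_pos.ne'

/-- The elements algebraic over `K` of an algebraically closed subfield `H` of a ring `R`. -/
theorem exists_algebraicClosure_subring {K R : Type*} [CommRing K] [CommRing R] (i : K →+* R)
    (hK : IsField K) (H : Subring R) (hH : IsField H) [CharZero H] (hi : ∀ k, i k ∈ H)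
    (hc : letI : Field H := hH.toField
      IsAlgClosed H) :
    ∃ (A : Subring R) (hA : IsField A) (hiA : ∀ k, i k ∈ A),
      (A : Set R) = {W | W ∈ H ∧ ∃ P : K[X], P.Monic ∧ Irreducible P ∧ P.eval₂ i W = 0} ∧
      (∀ P : K[X], P.Monic → Irreducible P →
        {W ∈ (A : Set R) | P.eval₂ i W = 0}.ncard = P.natDegree) ∧
      letI : Field A := hA.toField
      letI : Field K := hK.toField
      IsAlgClosed A ∧ IsAlgebraicClosureVia (i.codRestrict A hiA) := by
  let : Field H := hH.toField
  let : Field K := hK.toField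
  have : IsAlgClosed H := hc
  let : Algebra K H := (i.codRestrict H hi).toAlgebra
  have : CharZero H := ‹_›
  have : CharZero K := (algebraMap K H).charZero
  let L : IntermediateField K H := algebraicClosure K H
  have heval (P : K[X]) (W : H) : P.eval₂ i (W : R) = ((Polynomial.aeval W P : H) : R) := by
    rw [Polynomial.aeval_def]
    exact (Polynomial.hom_eval₂ P (algebraMap K H) H.subtype W).symm
  have heval0 (P : K[X]) (W : H) : P.eval₂ i (W : R) = 0 ↔ Polynomial.aeval W P = 0 := by
    rw [heval]
    exact ⟨fun h => Subtype.ext h, fun h => congrArg Subtype.val h⟩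
  -- The relative algebraic closure of `K` in `H`, viewed inside `R`.
  let A : Subring R := L.toSubfield.toSubring.map H.subtype
  have memA (W : H) : (W : R) ∈ A ↔ W ∈ L := by
    constructor
    · rintro ⟨V, hV, h⟩
      rwa [← Subtype.ext (a1 := V) (a2 := W) h]
    · exact fun h => ⟨W, h, rfl⟩
  let e : L ≃+* A :=
    L.toSubfield.toSubring.equivMapOfInjective H.subtype Subtype.val_injective
  have hA : IsField A := e.symm.toMulEquiv.isField (Field.toIsField L)
  have hiA (k : K) : i k ∈ A := ⟨algebraMap K H k, L.algebraMap_mem k, rfl⟩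
  have hset : (A : Set R) =
      {W | W ∈ H ∧ ∃ P : K[X], P.Monic ∧ Irreducible P ∧ P.eval₂ i W = 0} := by
    ext W
    constructor
    · rintro ⟨V, hV, rfl⟩
      have hint : IsIntegral K V := (mem_algebraicClosure_iff.1 hV).isIntegral
      exact ⟨V.2, minpoly K V, minpoly.monic hint, minpoly.irreducible hint,
        (heval0 _ V).2 (minpoly.aeval K V)⟩
    · rintro ⟨hW, P, hm, -, h0⟩
      exact (memA ⟨W, hW⟩).2 (mem_algebraicClosure_iff.2
        ⟨P, hm.ne_zero, (heval0 P ⟨W, hW⟩).1 h0⟩)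
  refine ⟨A, hA, hiA, hset, ?_, ?_⟩
  · intro P hm hP
    have himg : {W ∈ (A : Set R) | P.eval₂ i W = 0} = Subtype.val '' (P.rootSet H) := by
      ext W
      constructor
      · rintro ⟨hW, h0⟩
        rw [hset] at hW
        exact ⟨⟨W, hW.1⟩, (Polynomial.mem_rootSet_of_ne hm.ne_zero).2 ((heval0 P ⟨W, hW.1⟩).1 h0),
          rfl⟩
      · rintro ⟨V, hV, rfl⟩
        have h0 := (heval0 P V).2 ((Polynomial.mem_rootSet_of_ne hm.ne_zero).1 hV)
        refine ⟨?_, h0⟩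
        rw [hset]
        exact ⟨V.2, P, hm, hP, h0⟩
    rw [himg, Set.ncard_image_of_injective _ Subtype.val_injective, ← Nat.card_coe_set_eq,
      Nat.card_eq_fintype_card]
    -- Irreducible polynomials are separable in characteristic zero.
    exact Polynomial.card_rootSet_eq_natDegree hP.separable (IsAlgClosed.splits _)
  · let : Field A := hA.toField
    have hcl : IsAlgClosed A :=
      have : IsAlgClosed L := IsAlgClosure.isAlgClosed K
      IsAlgClosed.of_ringEquiv L A e
    refine ⟨hcl, ?_⟩
    let : Algebra K A := (i.codRestrict A hiA).toAlgebra
    refine ⟨hcl, ⟨?_⟩⟩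
    rintro ⟨W, hW⟩
    have hW' := hW
    rw [← SetLike.mem_coe, hset] at hW'
    obtain ⟨-, P, hm, -, h0⟩ := hW'
    refine ⟨P, hm.ne_zero, Subtype.ext ?_⟩
    rw [Polynomial.aeval_def]
    exact (Polynomial.hom_eval₂ P (algebraMap K A) A.subtype ⟨W, hW⟩).trans h0

/-! ### The field of meromorphic functions -/

section Meromorphic

variable {m : ℕ} {M : Type*} [TopologicalSpace M] [ChartedSpace (EuclideanSpace ℂ (Fin m)) M]

/-- Near any point where the local denominator is nonzero, `f` equals a holomorphic quotient. This
makes the germ of `f` along `G` holomorphic. -/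
theorem IsMeromorphic.dense_interior_contMDiffAt {f : M → ℂ} (hf : IsMeromorphic m f) :
    Dense (interior {x | ContMDiffAt 𝓘(ℂ, EuclideanSpace ℂ (Fin m)) 𝓘(ℂ, ℂ) ω f x}) := by
  intro x
  obtain ⟨U, hU, hx, g, h, hg, hh, hd, he⟩ := hf x
  have ho := hh.isOpen_ne_zero hU
  refine closure_mono (interior_maximal ?_ ho) (hd hx)
  have hquot : HolomorphicOn m (g * h⁻¹) {y ∈ U | h y ≠ 0} :=
    ContMDiffOn.mul (hg.mono fun y hy => hy.1)
      (HolomorphicOn.inv (hh.mono fun y hy => hy.1) fun y hy => hy.2)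
  intro y hy
  refine ((holomorphicOn_iff ho).1 hquot y hy).congr_of_eventuallyEq ?_
  filter_upwards [ho.mem_nhds hy] with z hz
  rw [he z hz.1 hz.2, div_eq_mul_inv]
  rfl

variable [IsManifold 𝓘(ℂ, EuclideanSpace ℂ (Fin m)) ω M] [ConnectedSpace M]

/-- A meromorphic function that is not generically zero is locally a quotient of holomorphic
functions neither of which vanishes on a nonempty open set. -/
theorem IsMeromorphic.exists_quotient {f : M → ℂ} (hf : IsMeromorphic m f)
    (h0 : ¬ f =ᶠ[denseOpen M] 0) (x : M) :
    ∃ V : Set M, IsOpen V ∧ x ∈ V ∧ ∃ g h : M → ℂ, HolomorphicOn m g V ∧ HolomorphicOn m h V ∧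
      V ⊆ closure {y ∈ V | g y * h y ≠ 0} ∧ ∀ y ∈ V, h y ≠ 0 → f y = g y / h y := by
  -- Values of `f` at zeros of a denominator are arbitrary, so vanishing is taken up to nowhere
  -- dense sets. `Z` is shown to be clopen; `Z = M` would make `f` generically zero, so `Z` is
  -- empty.
  let Z : Set M := interior (closure (interior {y | f y = 0}))
  have key (x : M) : ∃ V : Set M, IsOpen V ∧ x ∈ V ∧ ∃ g h : M → ℂ, HolomorphicOn m g V ∧
      HolomorphicOn m h V ∧ V ⊆ closure {y ∈ V | h y ≠ 0} ∧
      (∀ y ∈ V, h y ≠ 0 → f y = g y / h y) ∧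
      ∀ O ⊆ V, IsOpen O → O.Nonempty → (∀ y ∈ O, g y = 0) → x ∈ Z := by
    obtain ⟨U, hU, hx, g, h, hg, hh, hd, he⟩ := hf x
    obtain ⟨V, hVU, hV, hxV, hid⟩ := exists_nhds_identity (m := m) x hU hx
    have hdV : V ⊆ closure {y ∈ V | h y ≠ 0} := by
      intro y hy
      refine closure_mono ?_ (hV.inter_closure ⟨hy, hd (hVU hy)⟩)
      exact fun z hz => ⟨hz.1, hz.2.2⟩
    refine ⟨V, hV, hxV, g, h, hg.mono hVU, hh.mono hVU, hdV, fun y hy => he y (hVU hy), ?_⟩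
    intro O hOV hO hne hz
    -- Once `g` vanishes on all of `V`, `f` vanishes on the open set `h ≠ 0`, which is dense in `V`;
    -- hence `V ⊆ Z`.
    have hgV := hid g (hg.mono hVU) O hOV hO hne hz
    refine interior_maximal (hdV.trans (closure_mono (interior_maximal ?_ ?_))) hV hxV
    · intro y hy
      change f y = 0
      rw [he y (hVU hy.1) hy.2, hgV y hy.1, zero_div]
    · exact HolomorphicOn.isOpen_ne_zero (hh.mono hVU) hV
  have hclosed : IsClosed Z := by
    refine isClosed_of_closure_subset fun x hx => ?_
    obtain ⟨V, hV, hxV, g, h, hg, hh, hd, he, hz⟩ := key x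
    obtain ⟨y, hyV, hyZ⟩ := mem_closure_iff.1 hx V hV hxV
    obtain ⟨z, hzV, hzi⟩ := mem_closure_iff.1 (interior_subset hyZ) V hV hyV
    have ho := hh.isOpen_ne_zero hV
    obtain ⟨w, hwi, hw⟩ := mem_closure_iff.1 (hd hzV) _ isOpen_interior hzi
    refine hz ({y ∈ V | h y ≠ 0} ∩ interior {y | f y = 0}) (fun y hy => hy.1.1)
      (ho.inter isOpen_interior) ⟨w, hw, hwi⟩ fun y hy => ?_
    have hfy : f y = 0 := interior_subset (s := {y | f y = 0}) hy.2
    rw [he y hy.1.1 hy.1.2] at hfy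
    exact (div_eq_zero_iff.1 hfy).resolve_right hy.1.2
  have hZ : Z = ∅ := by
    rcases isClopen_iff.1 ⟨hclosed, isOpen_interior⟩ with h | h
    · exact h
    · refine absurd ?_ h0
      have hd : Dense (interior {y | f y = 0}) := fun y =>
        interior_subset (show y ∈ Z from h ▸ Set.mem_univ y)
      exact hd
  obtain ⟨V, hV, hxV, g, h, hg, hh, hd, he, hz⟩ := key x
  have hgd : V ⊆ closure {y ∈ V | g y ≠ 0} := by
    intro y hy
    by_contra hyc
    have hxZ : x ∈ Z := by
      refine hz (V ∩ (closure {y ∈ V | g y ≠ 0})ᶜ) Set.inter_subset_left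
        (hV.inter isClosed_closure.isOpen_compl) ⟨y, hy, hyc⟩ fun z hz => ?_
      by_contra hgz
      exact hz.2 (subset_closure ⟨hz.1, hgz⟩)
    simp [hZ] at hxZ
  have := dense_ne_zero_mul hV hV hg hgd hd
  rw [Set.inter_self] at this
  exact ⟨V, hV, hxV, g, h, hg, hh, this, he⟩

theorem IsMeromorphic.inv {f : M → ℂ} (hf : IsMeromorphic m f) (h0 : ¬ f =ᶠ[denseOpen M] 0) :
    IsMeromorphic m f⁻¹ := by
  intro x
  obtain ⟨V, hV, hxV, g, h, hg, hh, hd, he⟩ := hf.exists_quotient h0 x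
  -- The extra factor `h` makes the denominator vanish wherever `h` does, since `f = g / h` is known
  -- only off the zeros of `h`.
  refine ⟨V, hV, hxV, fun y => h y * h y, fun y => g y * h y, ContMDiffOn.mul hh hh,
    ContMDiffOn.mul hg hh, hd, fun y hy hy0 => ?_⟩
  have hh0 := right_ne_zero_of_mul hy0
  rw [Pi.inv_apply, he y hy hh0, inv_div, mul_div_mul_right _ _ hh0]

theorem IsMeromorphic.eventually_ne_zero {f : M → ℂ} (hf : IsMeromorphic m f)
    (h0 : ¬ f =ᶠ[denseOpen M] 0) : ∀ᶠ x in denseOpen M, f x ≠ 0 := by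
  change Dense (interior {x | f x ≠ 0})
  intro x
  obtain ⟨V, hV, hxV, g, h, hg, hh, hd, he⟩ := hf.exists_quotient h0 x
  refine closure_mono (interior_maximal ?_ ?_) (hd hxV)
  · intro y hy
    change f y ≠ 0
    rw [he y hy.1 (right_ne_zero_of_mul hy.2)]
    exact div_ne_zero (left_ne_zero_of_mul hy.2) (right_ne_zero_of_mul hy.2)
  · exact HolomorphicOn.isOpen_ne_zero (ContMDiffOn.mul hg hh) hV

variable (m M) in
theorem isField_meromorphicFunctions : IsField (MeromorphicFunctions m M) where
  exists_pair_ne := by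
    obtain ⟨G⟩ := GenericPlace.nonempty M
    have := G.neBot
    have : (denseOpen M).NeBot := Filter.neBot_of_le G.le_denseOpen
    exact exists_pair_ne _
  mul_comm := mul_comm
  mul_inv_cancel := by
    rintro ⟨_, f, hf, rfl⟩ hne
    have h0 : ¬ f =ᶠ[denseOpen M] 0 := fun h =>
      hne (Subtype.ext (Filter.Germ.coe_eq.2 h))
    refine ⟨⟨_, f⁻¹, hf.inv h0, rfl⟩, Subtype.ext (Filter.Germ.coe_eq.2 ?_)⟩
    filter_upwards [hf.eventually_ne_zero h0] with x hx
    exact mul_inv_cancel₀ hx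

end Meromorphic

/-! ### Holomorphic germs along a generic place: an algebraically closed field -/

section Germs

variable (m : ℕ) {M : Type*} [TopologicalSpace M] [ChartedSpace (EuclideanSpace ℂ (Fin m)) M]
  (G : GenericPlace M)

/-- The functions holomorphic on some open set of the generic place `G`. -/
def holomorphicFunctionsAt : Subring (M → ℂ) where
  carrier := {f | ∃ U ∈ G.toFilter, IsOpen U ∧ HolomorphicOn m f U}
  zero_mem' := ⟨Set.univ, Filter.univ_mem, isOpen_univ, contMDiffOn_const⟩
  one_mem' := ⟨Set.univ, Filter.univ_mem, isOpen_univ, contMDiffOn_const⟩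
  neg_mem' := by
    rintro f ⟨U, hU, hUo, hf⟩
    refine ⟨U, hU, hUo, ?_⟩
    have h : HolomorphicOn m (fun x => (-1) * f x) U := contMDiffOn_const.mul hf
    exact h.congr fun x _ => (neg_one_mul (f x)).symm
  add_mem' := by
    rintro f g ⟨U, hU, hUo, hf⟩ ⟨V, hV, hVo, hg⟩
    exact ⟨U ∩ V, Filter.inter_mem hU hV, hUo.inter hVo,
      ContMDiffOn.add (hf.mono Set.inter_subset_left) (hg.mono Set.inter_subset_right)⟩
  mul_mem' := by
    rintro f g ⟨U, hU, hUo, hf⟩ ⟨V, hV, hVo, hg⟩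
    exact ⟨U ∩ V, Filter.inter_mem hU hV, hUo.inter hVo,
      ContMDiffOn.mul (hf.mono Set.inter_subset_left) (hg.mono Set.inter_subset_right)⟩

/-- The germs along `G` of functions holomorphic on some open set of `G`. -/
def holomorphicGerms : Subring G.Germ :=
  (holomorphicFunctionsAt m G).map (Filter.Germ.coeRingHom G.toFilter)

/-- The map sending a function holomorphic on an open set of `G` to its germ. -/
def toHolomorphicGerms : holomorphicFunctionsAt m G →+* holomorphicGerms m G :=
  ((Filter.Germ.coeRingHom G.toFilter).comp (holomorphicFunctionsAt m G).subtype).codRestrict _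
    fun f => ⟨f, f.2, rfl⟩

variable {m G}

theorem mem_holomorphicFunctionsAt_iff {f : M → ℂ} :
    f ∈ holomorphicFunctionsAt m G ↔
      ∀ᶠ x in G.toFilter, ContMDiffAt 𝓘(ℂ, EuclideanSpace ℂ (Fin m)) 𝓘(ℂ, ℂ) ω f x := by
  constructor
  · rintro ⟨U, hU, hUo, hf⟩
    filter_upwards [hU] with x hx using (holomorphicOn_iff hUo).1 hf x hx
  · intro h
    obtain ⟨U, hU, hUo, hs⟩ := G.exists_isOpen _ h
    exact ⟨U, hU, hUo, (holomorphicOn_iff hUo).2 fun x hx => hs hx⟩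

theorem mem_holomorphicGerms_iff {W : G.Germ} : W ∈ holomorphicGerms m G ↔
    ∃ U ∈ G.toFilter, IsOpen U ∧ ∃ f : M → ℂ, HolomorphicOn m f U ∧ (f : G.Germ) = W := by
  constructor
  · rintro ⟨f, ⟨U, hU, hUo, hf⟩, rfl⟩
    exact ⟨U, hU, hUo, f, hf, rfl⟩
  · rintro ⟨U, hU, hUo, f, hf, rfl⟩
    exact ⟨f, ⟨U, hU, hUo, hf⟩, rfl⟩

theorem toHolomorphicGerms_surjective : Function.Surjective (toHolomorphicGerms m G) := by
  rintro ⟨_, f, hf, rfl⟩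
  exact ⟨⟨f, hf⟩, rfl⟩

theorem toHolomorphicGerms_eq_iff {f g : holomorphicFunctionsAt m G} :
    toHolomorphicGerms m G f = toHolomorphicGerms m G g ↔
      ∀ᶠ x in G.toFilter, (f : M → ℂ) x = (g : M → ℂ) x :=
  Subtype.ext_iff.trans Filter.Germ.coe_eq

theorem toGerm_mem_holomorphicGerms (φ : MeromorphicFunctions m M) :
    toGerm m G φ ∈ holomorphicGerms m G := by
  obtain ⟨_, f, hf, rfl⟩ := φ
  exact ⟨f, mem_holomorphicFunctionsAt_iff.2 (G.le_denseOpen hf.dense_interior_contMDiffAt), rfl⟩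

-- The dichotomy of `G` is applied to the nonvanishing locus of a representative.
variable (m G) in
theorem isField_holomorphicGerms : IsField (holomorphicGerms m G) where
  exists_pair_ne := by
    have := G.neBot
    exact exists_pair_ne _
  mul_comm := mul_comm
  mul_inv_cancel := by
    rintro ⟨_, f, ⟨U, hU, hUo, hf⟩, rfl⟩ hne
    have ho := hf.isOpen_ne_zero hUo
    rcases G.mem_or_exterior_mem _ ho with h | h
    · refine ⟨⟨_, f⁻¹, ⟨_, h, ho, HolomorphicOn.inv (hf.mono fun y hy => hy.1) fun y hy => hy.2⟩,
        rfl⟩, Subtype.ext (Filter.Germ.coe_eq.2 ?_)⟩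
      filter_upwards [h] with x hx
      exact mul_inv_cancel₀ hx.2
    · refine absurd (Subtype.ext (Filter.Germ.coe_eq.2 ?_)) hne
      filter_upwards [hU, h] with x hx hx'
      by_contra h0
      exact interior_subset hx' ⟨hx, h0⟩

instance : CharZero (holomorphicGerms m G) := by
  refine ⟨fun a b hab => ?_⟩
  have := G.neBot
  have h : ((a : holomorphicFunctionsAt m G) : M → ℂ) =ᶠ[G.toFilter]
      ((b : holomorphicFunctionsAt m G) : M → ℂ) :=
    toHolomorphicGerms_eq_iff.1 (by simpa using hab)
  obtain ⟨x, hx⟩ := h.exists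
  simpa using hx

/-- Evaluation at a point of a function holomorphic on an open set of `G`. -/
def evalAt (x : M) : holomorphicFunctionsAt m G →+* ℂ :=
  (Pi.evalRingHom (fun _ => ℂ) x).comp (holomorphicFunctionsAt m G).subtype

/-- Only finitely many coefficients matter, so one member of `G` serves them all. This carries the
Bézout identity from germs to points. -/
theorem eventually_map_evalAt_eq {p q : (holomorphicFunctionsAt m G)[X]}
    (h : p.map (toHolomorphicGerms m G) = q.map (toHolomorphicGerms m G)) :
    ∀ᶠ x in G.toFilter, p.map (evalAt x) = q.map (evalAt x) := by
  have hfin : ∀ᶠ x in G.toFilter, ∀ n ∈ p.support ∪ q.support,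
      evalAt x (p.coeff n) = evalAt x (q.coeff n) := by
    refine (Filter.eventually_all_finset _).2 fun n _ => toHolomorphicGerms_eq_iff.1 ?_
    simpa using congrArg (fun r => r.coeff n) h
  filter_upwards [hfin] with x hx
  ext n
  rw [Polynomial.coeff_map, Polynomial.coeff_map]
  by_cases hn : n ∈ p.support ∪ q.support
  · exact hx n hn
  · rw [Finset.mem_union, not_or, Polynomial.notMem_support_iff, Polynomial.notMem_support_iff]
      at hn
    rw [hn.1, hn.2]

/-- Near a point where the coefficients are holomorphic and the polynomial is separable, there is
a holomorphic root. -/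
theorem exists_local_root (p : (holomorphicFunctionsAt m G)[X]) (hp : p.Monic)
    (hdeg : p.natDegree ≠ 0) (x : M) (hsep : (p.map (evalAt x)).Separable)
    (hcoeff : ∀ n ∈ Finset.range (p.natDegree + 1),
      ContMDiffAt 𝓘(ℂ, EuclideanSpace ℂ (Fin m)) 𝓘(ℂ, ℂ) ω (p.coeff n : M → ℂ) x) :
    ∃ f : M → ℂ, ContMDiffAt 𝓘(ℂ, EuclideanSpace ℂ (Fin m)) 𝓘(ℂ, ℂ) ω f x ∧
      ∀ᶠ y in 𝓝 x, (p.map (evalAt y)).eval (f y) = 0 := by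
  set N := p.natDegree + 1
  have hnat (y : M) : (p.map (evalAt y)).natDegree < N :=
    Nat.lt_succ_of_le Polynomial.natDegree_map_le
  have heval (y : M) (w : ℂ) : (p.map (evalAt y)).eval w =
      ∑ i : Fin N, (p.coeff i : M → ℂ) y * w ^ (i : ℕ) := by
    rw [Polynomial.eval_eq_sum_range' (hnat y), ← Fin.sum_univ_eq_sum_range
      (fun i => (p.map (evalAt y)).coeff i * w ^ i)]
    simp only [Polynomial.coeff_map]
    rfl
  -- Monicity keeps the degree from dropping under specialisation at `x`.
  obtain ⟨w, hw⟩ := IsAlgClosed.exists_root (p.map (evalAt x)) (by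
    rw [Polynomial.degree_eq_natDegree (hp.map _).ne_zero, hp.natDegree_map]
    exact_mod_cast hdeg)
  -- A common root of the polynomial and its derivative would turn the Bézout identity into `0 = 1`.
  have hder : (p.map (evalAt x)).derivative.eval w ≠ 0 := by
    intro h0
    obtain ⟨a, b, hab⟩ := hsep
    have := congrArg (Polynomial.eval w) hab
    rw [Polynomial.eval_add, Polynomial.eval_mul, Polynomial.eval_mul, hw.eq_zero, h0] at this
    simp at this
  obtain ⟨r, hr, hroot⟩ := exists_contDiffAt_root (fun i : Fin N => (p.coeff i : M → ℂ) x) w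
    (by rw [← heval]; exact hw) (by
      convert hder using 1
      rw [Polynomial.derivative_eval, Polynomial.sum_over_range' _ (by simp) N (hnat x),
        ← Fin.sum_univ_eq_sum_range
          (fun i => (p.map (evalAt x)).coeff i * i * w ^ (i - 1))]
      simp only [Polynomial.coeff_map, mul_assoc]
      rfl)
  have hB : ContMDiffAt 𝓘(ℂ, EuclideanSpace ℂ (Fin m)) 𝓘(ℂ, Fin N → ℂ) ω
      (fun y (i : Fin N) => (p.coeff i : M → ℂ) y) x :=
    contMDiffAt_pi_space.2 fun i => hcoeff i (Finset.mem_range.2 i.2)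
  refine ⟨fun y => r fun i : Fin N => (p.coeff i : M → ℂ) y, hr.comp_contMDiffAt hB, ?_⟩
  filter_upwards [hB.continuousAt.eventually hroot] with y hy
  rw [heval]
  exact hy

theorem exists_root_holomorphicGerms [IsManifold 𝓘(ℂ, EuclideanSpace ℂ (Fin m)) ω M]
    (P : (holomorphicGerms m G)[X]) (hm : P.Monic)
    (hsep : P.Separable) (hdeg : P.natDegree ≠ 0) : ∃ W, P.eval W = 0 := by
  have hlift (Q : (holomorphicGerms m G)[X]) : Q ∈ Polynomial.lifts (toHolomorphicGerms m G) :=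
    Polynomial.mem_lifts_of_surjective toHolomorphicGerms_surjective Q
  obtain ⟨p, hpP, hpd, hpm⟩ := Polynomial.lifts_and_natDegree_eq_and_monic (hlift P) hm
  obtain ⟨A, B, hAB⟩ := hsep
  obtain ⟨a, rfl⟩ := (Polynomial.mem_lifts _).1 (hlift A)
  obtain ⟨b, rfl⟩ := (Polynomial.mem_lifts _).1 (hlift B)
  have hsepx : ∀ᶠ x in G.toFilter, (p.map (evalAt x)).Separable := by
    have := eventually_map_evalAt_eq (p := a * p + b * p.derivative) (q := 1) (by
      simpa [← Polynomial.derivative_map, hpP] using hAB)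
    filter_upwards [this] with x hx
    exact ⟨a.map (evalAt x), b.map (evalAt x), by
      simpa [← Polynomial.derivative_map] using hx⟩
  have hcoeff : ∀ᶠ x in G.toFilter, ∀ n ∈ Finset.range (p.natDegree + 1),
      ContMDiffAt 𝓘(ℂ, EuclideanSpace ℂ (Fin m)) 𝓘(ℂ, ℂ) ω (p.coeff n : M → ℂ) x :=
    (Filter.eventually_all_finset _).2 fun n _ => mem_holomorphicFunctionsAt_iff.1 (p.coeff n).2
  have hV := hsepx.and hcoeff
  -- Being holomorphic at `x` and a root there depends only on the germ of `f` at `x`, so local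
  -- roots can be glued.
  obtain ⟨W, hWo, hVW, f, hf⟩ := exists_dense_solution
    (fun (f : M → ℂ) x => ContMDiffAt 𝓘(ℂ, EuclideanSpace ℂ (Fin m)) 𝓘(ℂ, ℂ) ω f x ∧
      (p.map (evalAt x)).eval (f x) = 0)
    (fun f g x hfg hf => ⟨hf.1.congr_of_eventuallyEq hfg.symm, hfg.eq_of_nhds ▸ hf.2⟩) _
    (fun x (hx : x ∈ {x | (p.map (evalAt x)).Separable ∧ _}) => by
      obtain ⟨f, hf, hroot⟩ := exists_local_root p hpm (hpd ▸ hdeg) x hx.1 hx.2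
      exact ⟨f, ((contMDiffAt_iff_contMDiffAt_nhds (by simp)).1 hf).and hroot⟩)
  have hWG : W ∈ G.toFilter := G.mem_of_subset_closure hV hWo hVW
  let F : holomorphicFunctionsAt m G :=
    ⟨f, mem_holomorphicFunctionsAt_iff.2 (by filter_upwards [hWG] with x hx using (hf x hx).1)⟩
  refine ⟨toHolomorphicGerms m G F, ?_⟩
  rw [← hpP, Polynomial.eval_map_apply, ← map_zero (toHolomorphicGerms m G),
    toHolomorphicGerms_eq_iff]
  filter_upwards [hWG] with x hx
  have := (hf x hx).2
  exact (Polynomial.eval_map_apply (f := evalAt (m := m) (G := G) x) (p := p) F).symm.trans this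

end Germs

end Algebroid

end

/-! ### The main theorem -/

theorem mainTheorem12 (m : ℕ) (M : Type*) [TopologicalSpace M]
    [ChartedSpace (EuclideanSpace ℂ (Fin m)) M]
    [IsManifold 𝓘(ℂ, EuclideanSpace ℂ (Fin m)) ω M] [ConnectedSpace M]
    (G : Algebroid.GenericPlace M) :
    ∃ (A : Subring G.Germ) (hA : IsField A) (hM : IsField (Algebroid.MeromorphicFunctions m M))
      (hMA : ∀ φ, Algebroid.toGerm m G φ ∈ A),
      (A : Set G.Germ) = Algebroid.algebroidFunctions m G ∧
      (∀ P : (Algebroid.MeromorphicFunctions m M)[X], P.Monic → Irreducible P →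
        {W ∈ Algebroid.algebroidFunctions m G |
          P.eval₂ (Algebroid.toGerm m G) W = 0}.ncard = P.natDegree) ∧
      letI : Field A := hA.toField
      letI : Field (Algebroid.MeromorphicFunctions m M) := hM.toField
      IsAlgClosed A ∧
        Algebroid.IsAlgebraicClosureVia ((Algebroid.toGerm m G).codRestrict A hMA) := by
  have hM := Algebroid.isField_meromorphicFunctions m M
  have hH := Algebroid.isField_holomorphicGerms m G
  obtain ⟨A, hA, hMA, hset, hcount, hcl⟩ := Algebroid.exists_algebraicClosure_subring
    (Algebroid.toGerm m G) hM _ hH Algebroid.toGerm_mem_holomorphicGerms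
    (hH.isAlgClosed_of_exists_root Algebroid.exists_root_holomorphicGerms)
  have hset' : (A : Set G.Germ) = Algebroid.algebroidFunctions m G := by
    rw [hset]
    ext W
    exact and_congr_left' Algebroid.mem_holomorphicGerms_iff
  rw [hset'] at hcount
  exact ⟨A, hA, hM, hMA, hset', hcount, hcl⟩
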